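/- Conventions. Let $A$ be a Noetherian ring and $I$ an ideal of $A$. The integral closure $\overline{I}$ is the ideal of all $\alpha\in A$ satisfying an equation $\alpha^n+c_1\alpha^{n-1}+\cdots+c_n=0$ with $n\ge 1$ and $c_i\in I^i$; the ideal $I$ is complete if $I=\overline{I}$. Ideals $I$ and $J$ of $A$ are projectively equivalent if $\overline{I^j}=\overline{J^i}$ for some positive integers $i,j$. A proper ideal $I$ containing a nonzerodivisor is projectively full if every complete ideal $J$ of $A$ that is projectively equivalent to $I$ is of the form $J=\overline{I^k}$ for some positive integer $k$. For an ideal $I\neq 0$ of a Noetherian domain $R$ with field of fractions $K$, the Rees valuation rings of $I$ are the rings $B_Q$, where $B$ is the integral closure of $R[I/a]$ in $K$ for some $0\ne a\in I$, and $Q$ is a height-one prime of $B$ containing $I$. If $R\subseteq T$ are UFDs with the same field of fractions and $I$ is an ideal of $R$ that is not contained in any proper principal ideal, the transform of $I$ in $T$ is the ideal $I^T=a^{-1}IT$, where $aT$ is the smallest principal ideal of $T$ containing $IT$. Proposition 4.7. Let $(R,\mathfrak m)$ be a regular local ring of dimension $d\ge 2$ with infinite residue field, and let $I$ be a complete $\mathfrak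 m$-primary ideal of $R$. Let $x\in\mathfrak m\setminus\mathfrak m^2$ be such that $xV=\mathfrak mV$ for every Rees valuation ring $V$ of $I$, let $S_1=R[\mathfrak m/x]$ be the subring of the field of fractions of $R$ generated over $R$ by the elements $y/x$ with $y\in\mathfrak m$, and let $I_1$ be the transform of $I$ in $S_1$ (equivalently, $IS_1=x^rI_1$, where $r$ is the integer with $I\subseteq\mathfrak m^r$ and $I\not\subseteq\mathfrak m^{r+1}$). If $I_1$ is projectively full in $S_1$ (in particular $I_1\neq S_1$), then $I$ is projectively full in $R$. -/

import Mathlib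

open IsLocalRing

namespace ProjFull

section IntegralClosure

open Polynomial

variable {A : Type*} [CommRing A]

/-- `a` is integral over the ideal `I`: it satisfies an equation
`a ^ n + c₁ a ^ (n - 1) + ⋯ + cₙ = 0` with `n ≥ 1` and `cᵢ ∈ I ^ i`. -/
def IsIntegralOverIdeal (I : Ideal A) (a : A) : Prop :=
  ∃ n : ℕ, 0 < n ∧ ∃ c : ℕ → A, (∀ i ∈ Finset.Icc 1 n, c i ∈ I ^ i) ∧
    a ^ n + ∑ i ∈ Finset.Icc 1 n, c i * a ^ (n - i) = 0

/-- Integrality over `I` is integrality of `a t` over the Rees algebra `A[It] ⊆ A[t]`. This is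
used to see that the elements integral over `I` form an ideal. -/
theorem isIntegralOverIdeal_iff (I : Ideal A) (a : A) :
    IsIntegralOverIdeal I a ↔ IsIntegral (reesAlgebra I) (monomial 1 a : A[X]) := by
  constructor
  · rintro ⟨n, hn, c, hc, h⟩
    let d : ℕ → reesAlgebra I := fun i =>
      if hi : i ∈ Finset.Icc 1 n then ⟨monomial i (c i), reesAlgebra.monomial_mem.2 (hc i hi)⟩
      else 0
    refine ⟨X ^ n + ∑ i ∈ Finset.Icc 1 n, C (d i) * X ^ (n - i), ?_, ?_⟩
    · refine monic_X_pow_add ?_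
      rw [← mem_degreeLT]
      refine Submodule.sum_mem _ fun i hi => ?_
      rw [mem_degreeLT]
      refine (degree_C_mul_X_pow_le _ _).trans_lt ?_
      rw [Finset.mem_Icc] at hi
      exact_mod_cast (by omega : n - i < n)
    · rw [eval₂_add, eval₂_finsetSum, eval₂_X_pow]
      have key : ∀ i ∈ Finset.Icc 1 n,
          eval₂ (algebraMap (reesAlgebra I) A[X]) (monomial 1 a : A[X])
            (C (d i) * X ^ (n - i)) = monomial n (c i * a ^ (n - i)) := by
        intro i hi
        have hi' := Finset.mem_Icc.1 hi
        rw [eval₂_mul, eval₂_C, eval₂_X_pow, monomial_pow]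
        have : algebraMap (reesAlgebra I) A[X] (d i) = monomial i (c i) := by
          simp only [d, dif_pos hi]; rfl
        rw [this, monomial_mul_monomial]
        congr 2
        omega
      rw [Finset.sum_congr rfl key, monomial_pow, one_mul, ← map_sum, ← map_add, h, map_zero]
  · rintro ⟨p, hp, h⟩
    have hq : (p * X).Monic := hp.mul monic_X
    have h' : eval₂ (algebraMap (reesAlgebra I) A[X]) (monomial 1 a : A[X]) (p * X) = 0 := by
      rw [eval₂_mul, h, zero_mul]
    obtain ⟨N, hN, q, hqd, hq0, hq1⟩ : ∃ N, 0 < N ∧ ∃ q : (reesAlgebra I)[X],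
        q.natDegree < N + 1 ∧
        eval₂ (algebraMap (reesAlgebra I) A[X]) (monomial 1 a : A[X]) q = 0 ∧ q.coeff N = 1 := by
      cases subsingleton_or_nontrivial A with
      | inl _ =>
        have : Subsingleton (reesAlgebra I) := ⟨fun u v => Subtype.ext (Subsingleton.elim _ _)⟩
        exact ⟨1, one_pos, p * X, by simp [Subsingleton.elim (p * X) 0],
          h', Subsingleton.elim _ _⟩
      | inr _ =>
        refine ⟨(p * X).natDegree, ?_, p * X, Nat.lt_succ_self _, h', hq.coeff_natDegree⟩
        rw [hp.natDegree_mul monic_X, natDegree_X]; omega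
    refine ⟨N, hN, fun i => ((q.coeff (N - i) : reesAlgebra I) : A[X]).coeff i, ?_, ?_⟩
    · intro i _
      exact (q.coeff (N - i)).2 i
    · rw [eval₂_eq_sum_range' _ hqd] at hq0
      have h0 := congrArg (fun f : A[X] => f.coeff N) hq0
      simp only [finsetSum_coeff, coeff_zero, monomial_pow, one_mul] at h0
      have e : ∀ i ∈ Finset.range (N + 1),
          (algebraMap (reesAlgebra I) A[X] (q.coeff i) * monomial i (a ^ i)).coeff N
            = ((q.coeff i : reesAlgebra I) : A[X]).coeff (N - i) * a ^ i := by
        intro i hi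
        have hi' : N = (N - i) + i := by have := Finset.mem_range.1 hi; omega
        conv_lhs => rw [hi']
        rw [coeff_mul_monomial]
        rfl
      rw [Finset.sum_congr rfl e, ← Finset.sum_range_reflect, Finset.sum_range_succ'] at h0
      rw [← h0, add_comm]
      congr 1
      · refine Finset.sum_bij' (fun i _ => i - 1) (fun i _ => i + 1) ?_ ?_ ?_ ?_ ?_
        · intro i hi; have := Finset.mem_Icc.1 hi; exact Finset.mem_range.2 (by omega)
        · intro i hi; have := Finset.mem_range.1 hi; exact Finset.mem_Icc.2 (by omega)
        · intro i hi; have := Finset.mem_Icc.1 hi; omega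
        · intro i hi; rfl
        · intro i hi
          have hi := Finset.mem_Icc.1 hi
          have e1 : N + 1 - 1 - (i - 1 + 1) = N - i := by omega
          have e2 : N - (N - i) = i := by omega
          rw [e1, e2]
      · simp [hq1]

/-- The integral closure of the ideal `I`: the ideal of all elements that are integral over `I`. -/
def idealClosure (I : Ideal A) : Ideal A where
  carrier := {a | IsIntegralOverIdeal I a}
  zero_mem' := by
    change IsIntegralOverIdeal I 0
    rw [isIntegralOverIdeal_iff, map_zero]
    exact isIntegral_zero
  add_mem' := by
    intro a b ha hb
    change IsIntegralOverIdeal I _ at ha hb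
    change IsIntegralOverIdeal I _
    rw [isIntegralOverIdeal_iff] at *
    rw [map_add]
    exact ha.add hb
  smul_mem' := by
    rintro r a ⟨n, hn, c, hc, h⟩
    refine ⟨n, hn, fun i => r ^ i * c i, fun i hi => Ideal.mul_mem_left _ _ (hc i hi), ?_⟩
    have e : ∀ i ∈ Finset.Icc 1 n,
        r ^ i * c i * (r • a) ^ (n - i) = r ^ n * (c i * a ^ (n - i)) := by
      intro i hi
      have hi := Finset.mem_Icc.1 hi
      have : r ^ n = r ^ i * r ^ (n - i) := by rw [← pow_add]; congr 1; omega
      rw [smul_eq_mul, mul_pow, this]; ring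
    rw [Finset.sum_congr rfl e, ← Finset.mul_sum, smul_eq_mul, mul_pow, ← mul_add, h, mul_zero]

/-- An ideal is complete (integrally closed) if it equals its integral closure. -/
def IsCompleteIdeal (I : Ideal A) : Prop :=
  idealClosure I = I

/-- `I` and `J` are projectively equivalent: some (positive) powers of them have the same integral
closure. -/
def ProjectivelyEquivalent (I J : Ideal A) : Prop :=
  ∃ i j : ℕ, 0 < i ∧ 0 < j ∧ idealClosure (I ^ j) = idealClosure (J ^ i)

/-- A regular (i.e. containing a nonzerodivisor) proper ideal `I` is projectively full if the only
complete ideals projectively equivalent to it are the integral closures of its powers. -/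
structure IsProjectivelyFull (I : Ideal A) : Prop where
  proper : I ≠ ⊤
  regular : ∃ a ∈ I, a ∈ nonZeroDivisors A
  full : ∀ J : Ideal A, IsCompleteIdeal J → ProjectivelyEquivalent I J →
    ∃ k : ℕ, 0 < k ∧ J = idealClosure (I ^ k)

end IntegralClosure

section Birational

variable {R : Type*} [CommRing R] (K : Type*) [Field K] [Algebra R K]

/-- The subring `R[I/a]` of the field of fractions `K` of `R`, generated over `R` by the
quotients `y / a` with `y ∈ I`. -/
def blowupChart (I : Ideal R) (a : R) : Subalgebra R K :=
  Algebra.adjoin R {z : K | ∃ y ∈ I, z = algebraMap R K y / algebraMap R K a}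

/-- The Rees valuation rings of an ideal `I` of a Noetherian domain `R` with field of fractions
`K`: the rings `B_Q`, where `B` is the integral closure of `R[I/a]` in `K` for some nonzero
`a ∈ I` and `Q` is a height-one prime of `B` that contains `I`. -/
def reesValuationRings (I : Ideal R) : Set (ValuationSubring K) :=
  {V | ∃ a ∈ I, a ≠ 0 ∧ ∃ Q : Ideal (integralClosure (blowupChart K I a) K),
    Q.IsPrime ∧ Q.height = 1 ∧
    I.map (algebraMap R (integralClosure (blowupChart K I a) K)) ≤ Q ∧
    ∀ z : K, z ∈ V ↔ ∃ b s : integralClosure (blowupChart K I a) K,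
      s ∉ Q ∧ z = (b : K) / (s : K)}

variable {K}

/-- `xV = IV` for a valuation ring `V` of `K`, as an equality of `V`-submodules of `K`. -/
def GeneratesIn (x : R) (I : Ideal R) (V : ValuationSubring K) : Prop :=
  Submodule.span V {algebraMap R K x} = Submodule.span V (algebraMap R K '' (I : Set R))

/-- `I'` is the transform `I ^ T = a⁻¹ I T` of the ideal `I` of `R` in the extension ring `T`,
where `aT` is the smallest principal ideal of `T` that contains `IT`. -/
def IsTransform {T : Type*} [CommRing T] [Algebra R T] (I : Ideal R) (I' : Ideal T) : Prop :=
  ∃ a : T, a ≠ 0 ∧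
    IsLeast {P : Ideal T | Submodule.IsPrincipal P ∧ I.map (algebraMap R T) ≤ P}
      (Ideal.span {a}) ∧
    I.map (algebraMap R T) = Ideal.span {a} * I'

end Birational

end ProjFull

/-! Write `S₁ = R[𝔪/x]`. The graded ring of `R` along `𝔪` is a domain, so `x` is prime in `S₁`
(`prime_algebraMap_blowupChart`). As `I` contains a power of `x`, `I S₁ = x^r I₁` with `I₁` not
inside `(x)`. Let `J` be complete, with `I^j` and `J^i` having the same integral closure. Then `J`
also contains a power of `x`, and `J S₁ = x^s J₁` with `J₁` not inside `(x)`.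

Extending to `S₁`, the ideals `x^(rj) I₁^j` and `x^(si) J₁^i` have the same closure. Powers of the
prime `x` generate complete ideals, so `rj = si` (`mul_le_mul_of_idealClosure_le`), and the factor
cancels. Fullness of `I₁` makes the closure of `J₁` that of some `I₁^k`. Hence `I₁^j` and `I₁^(ki)`
have the same closure, and a valuation centered on `I₁` gives `j = ki`
(`pow_eq_of_idealClosure_pow_eq`). Only this numerical equality returns to `R`: `I^(ki)` and `J^i`
have the same closure, and taking `i`-th roots gives that `J` is the closure of `I^k`. -/

namespace ProjFull

/-! ### Integral closure of ideals via the Rees algebra -/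

section Closure

open Polynomial

variable {A : Type*} [CommRing A]

theorem mem_idealClosure {I : Ideal A} {a : A} : a ∈ idealClosure I ↔ IsIntegralOverIdeal I a :=
  Iff.rfl

/-- `a` is integral over the ideal `I ^ n` if and only if `a t ^ n` is integral over the Rees
algebra of `I`. -/
theorem isIntegralOverIdeal_pow_iff (I : Ideal A) (n : ℕ) (a : A) :
    IsIntegralOverIdeal (I ^ n) a ↔ IsIntegral (reesAlgebra I) (monomial n a : A[X]) := by
  constructor
  · intro h
    rw [isIntegralOverIdeal_iff] at h
    -- The substitution `t ↦ t ^ n` carries the Rees algebra of `I ^ n` into that of `I`.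
    have hmem : ∀ f : reesAlgebra (I ^ n), expand A n (f : A[X]) ∈ reesAlgebra I := by
      intro f
      rw [expand_eq_sum, Polynomial.sum]
      refine Subalgebra.sum_mem _ fun i _ => ?_
      rw [← pow_mul, C_mul_X_pow_eq_monomial, reesAlgebra.monomial_mem, pow_mul]
      exact f.2 i
    let φ : reesAlgebra (I ^ n) →+* reesAlgebra I :=
      ((expand A n : A[X] →ₐ[A] A[X]) : A[X] →+* A[X]).comp
        (reesAlgebra (I ^ n)).val.toRingHom |>.codRestrict (reesAlgebra I) hmem
    have := IsIntegral.map_of_comp_eq φ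
      ((expand A n : A[X] →ₐ[A] A[X]) : A[X] →+* A[X]) (RingHom.ext fun f => rfl) h
    simpa using this
  · rintro ⟨p, hp, h⟩
    -- The extra factor `X` makes the degree positive even when `p = 1`.
    have hq : (p * X).Monic := hp.mul monic_X
    have h' : eval₂ (algebraMap (reesAlgebra I) A[X]) (monomial n a : A[X]) (p * X) = 0 := by
      rw [eval₂_mul, h, zero_mul]
    obtain ⟨N, hN, q, hqd, hq0, hq1⟩ : ∃ N, 0 < N ∧ ∃ q : (reesAlgebra I)[X],
        q.natDegree < N + 1 ∧
        eval₂ (algebraMap (reesAlgebra I) A[X]) (monomial n a : A[X]) q = 0 ∧ q.coeff N = 1 := by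
      cases subsingleton_or_nontrivial A with
      | inl _ =>
        have : Subsingleton (reesAlgebra I) := ⟨fun u v => Subtype.ext (Subsingleton.elim _ _)⟩
        exact ⟨1, one_pos, p * X, by simp [Subsingleton.elim (p * X) 0],
          h', Subsingleton.elim _ _⟩
      | inr _ =>
        refine ⟨(p * X).natDegree, ?_, p * X, Nat.lt_succ_self _, h', hq.coeff_natDegree⟩
        rw [hp.natDegree_mul monic_X, natDegree_X]; omega
    -- Compare coefficients of `t ^ (n * N)`: the coefficient of `q` at `N - i` contributes through
    -- its part of degree `n * i`, which lies in `(I ^ n) ^ i`.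
    refine ⟨N, hN, fun i => ((q.coeff (N - i) : reesAlgebra I) : A[X]).coeff (n * i), ?_, ?_⟩
    · intro i _
      rw [← pow_mul]
      exact (q.coeff (N - i)).2 (n * i)
    · rw [eval₂_eq_sum_range' _ hqd] at hq0
      have h0 := congrArg (fun f : A[X] => f.coeff (n * N)) hq0
      simp only [finsetSum_coeff, coeff_zero, monomial_pow] at h0
      have e : ∀ i ∈ Finset.range (N + 1),
          (algebraMap (reesAlgebra I) A[X] (q.coeff i) * monomial (n * i) (a ^ i)).coeff (n * N)
            = ((q.coeff i : reesAlgebra I) : A[X]).coeff (n * (N - i)) * a ^ i := by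
        intro i hi
        have hi' : n * N = n * (N - i) + n * i := by
          have := Finset.mem_range.1 hi
          rw [← mul_add]; congr 1; omega
        conv_lhs => rw [hi']
        rw [coeff_mul_monomial]
        rfl
      rw [Finset.sum_congr rfl e, ← Finset.sum_range_reflect, Finset.sum_range_succ'] at h0
      rw [← h0, add_comm]
      congr 1
      · refine Finset.sum_bij' (fun i _ => i - 1) (fun i _ => i + 1) ?_ ?_ ?_ ?_ ?_
        · intro i hi; have := Finset.mem_Icc.1 hi; exact Finset.mem_range.2 (by omega)
        · intro i hi; have := Finset.mem_range.1 hi; exact Finset.mem_Icc.2 (by omega)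
        · intro i hi; have := Finset.mem_Icc.1 hi; omega
        · intro i hi; rfl
        · intro i hi
          have hi := Finset.mem_Icc.1 hi
          have e1 : N + 1 - 1 - (i - 1 + 1) = N - i := by omega
          have e2 : N - (N - i) = i := by omega
          rw [e1, e2]
      · simp [hq1]

theorem le_idealClosure (I : Ideal A) : I ≤ idealClosure I := fun a ha =>
  ⟨1, one_pos, fun _ => -a, by simpa using ha, by simp⟩

theorem idealClosure_mono {I J : Ideal A} (h : I ≤ J) : idealClosure I ≤ idealClosure J := by
  rintro a ⟨n, hn, c, hc, e⟩
  exact ⟨n, hn, c, fun i hi => Ideal.pow_right_mono h i (hc i hi), e⟩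

/-- A Rees algebra is generated in degree one, where integrality is the definition of the closure.
-/
theorem isIntegral_of_mem_reesAlgebra_idealClosure {I : Ideal A} {f : A[X]}
    (hf : f ∈ reesAlgebra (idealClosure I)) : IsIntegral (reesAlgebra I) f := by
  rw [← adjoin_monomial_eq_reesAlgebra] at hf
  refine Algebra.adjoin_induction ?_ ?_ (fun _ _ _ _ h h' => h.add h')
    (fun _ _ _ _ h h' => h.mul h') hf
  · rintro _ ⟨a, ha, rfl⟩
    exact (isIntegralOverIdeal_iff I a).1 ha
  · intro r
    exact isIntegral_algebraMap (x := algebraMap A (reesAlgebra I) r)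

/-- The product of `n` elements integral over `I` is integral over `I ^ n`. -/
theorem idealClosure_pow_le (I : Ideal A) (n : ℕ) :
    idealClosure I ^ n ≤ idealClosure (I ^ n) := fun _ ha =>
  (isIntegralOverIdeal_pow_iff I n _).2
    (isIntegral_of_mem_reesAlgebra_idealClosure (reesAlgebra.monomial_mem.2 ha))

theorem idealClosure_idealClosure (I : Ideal A) :
    idealClosure (idealClosure I) = idealClosure I := by
  refine le_antisymm (fun a ha => ?_) (le_idealClosure _)
  have ha := (isIntegralOverIdeal_iff _ a).1 ha
  refine (isIntegralOverIdeal_iff _ a).2 ?_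
  let φ : reesAlgebra (idealClosure I) →+* integralClosure (reesAlgebra I) A[X] :=
    (reesAlgebra (idealClosure I)).val.toRingHom.codRestrict _
      fun f => isIntegral_of_mem_reesAlgebra_idealClosure f.2
  have hφ : (algebraMap (integralClosure (reesAlgebra I) A[X]) A[X]).comp φ =
      (RingHom.id A[X]).comp (algebraMap (reesAlgebra (idealClosure I)) A[X]) := rfl
  exact isIntegral_trans (R := reesAlgebra I) (A := integralClosure (reesAlgebra I) A[X]) _
    (IsIntegral.map_of_comp_eq φ (RingHom.id A[X]) hφ ha)

theorem idealClosure_le_iff {I J : Ideal A} :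
    idealClosure I ≤ idealClosure J ↔ I ≤ idealClosure J :=
  ⟨(le_idealClosure I).trans, fun h =>
    (idealClosure_mono h).trans (idealClosure_idealClosure J).le⟩

theorem idealClosure_idealClosure_pow (I : Ideal A) (n : ℕ) :
    idealClosure (idealClosure I ^ n) = idealClosure (I ^ n) :=
  le_antisymm (idealClosure_le_iff.2 (idealClosure_pow_le I n))
    (idealClosure_mono (Ideal.pow_right_mono (le_idealClosure I) n))

/-- In the Rees picture `a ^ n * t ^ n` is the `n`-th power of `a * t`, and an element with an
integral power is integral. -/
theorem mem_idealClosure_of_pow_mem {I : Ideal A} {n : ℕ} (hn : 0 < n) {a : A}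
    (ha : a ^ n ∈ idealClosure (I ^ n)) : a ∈ idealClosure I := by
  have h := (isIntegralOverIdeal_pow_iff I n _).1 ha
  refine (isIntegralOverIdeal_iff _ a).2 (IsIntegral.of_pow hn ?_)
  simpa [monomial_pow] using h

theorem idealClosure_le_of_pow {I J : Ideal A} {n : ℕ} (hn : 0 < n)
    (h : idealClosure (I ^ n) ≤ idealClosure (J ^ n)) : idealClosure I ≤ idealClosure J :=
  idealClosure_le_iff.2 fun _ ha => mem_idealClosure_of_pow_mem hn
    (h (le_idealClosure _ (Ideal.pow_mem_pow ha n)))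

theorem idealClosure_eq_of_pow {I J : Ideal A} {n : ℕ} (hn : 0 < n)
    (h : idealClosure (I ^ n) = idealClosure (J ^ n)) : idealClosure I = idealClosure J :=
  le_antisymm (idealClosure_le_of_pow hn h.le) (idealClosure_le_of_pow hn h.ge)

theorem map_idealClosure_le {B : Type*} [CommRing B] (f : A →+* B) (I : Ideal A) :
    (idealClosure I).map f ≤ idealClosure (I.map f) := by
  rw [Ideal.map_le_iff_le_comap]
  rintro a ⟨n, hn, c, hc, e⟩
  refine ⟨n, hn, fun i => f (c i), fun i hi => ?_, ?_⟩
  · rw [← Ideal.map_pow]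
    exact Ideal.mem_map_of_mem f (hc i hi)
  · simpa using congrArg f e

theorem idealClosure_map_congr {B : Type*} [CommRing B] (f : A →+* B) {I J : Ideal A}
    (h : idealClosure I = idealClosure J) :
    idealClosure (I.map f) = idealClosure (J.map f) := by
  apply le_antisymm <;> refine idealClosure_le_iff.2 (le_trans (Ideal.map_mono ?_)
    (map_idealClosure_le f _))
  · exact h ▸ le_idealClosure I
  · exact h ▸ le_idealClosure J

/-- Multiplying an integral equation for `a` by `y ^ n` gives one for `y * a`, with `cᵢ` replaced by
`y ^ i * cᵢ`; this is reversible because `y` is a nonzerodivisor. -/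
theorem mul_mem_idealClosure_iff {y : A} (hy : y ∈ nonZeroDivisors A) {L : Ideal A} {a : A} :
    y * a ∈ idealClosure (Ideal.span {y} * L) ↔ a ∈ idealClosure L := by
  have key : ∀ (n : ℕ) (c : ℕ → A),
      (y * a) ^ n + ∑ i ∈ Finset.Icc 1 n, y ^ i * c i * (y * a) ^ (n - i) =
        y ^ n * (a ^ n + ∑ i ∈ Finset.Icc 1 n, c i * a ^ (n - i)) := by
    intro n c
    rw [mul_add, Finset.mul_sum, mul_pow]
    congr 1
    refine Finset.sum_congr rfl fun i hi => ?_
    have hi := Finset.mem_Icc.1 hi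
    have : y ^ n = y ^ i * y ^ (n - i) := by rw [← pow_add]; congr 1; omega
    rw [mul_pow, this]; ring
  constructor
  · rintro ⟨n, hn, c, hc, e⟩
    have hd : ∀ i, ∃ d, i ∈ Finset.Icc 1 n → d ∈ L ^ i ∧ y ^ i * d = c i := by
      intro i
      by_cases hi : i ∈ Finset.Icc 1 n
      · have := hc i hi
        rw [mul_pow, Ideal.span_singleton_pow, Ideal.mem_span_singleton_mul] at this
        obtain ⟨d, hd, hd'⟩ := this
        exact ⟨d, fun _ => ⟨hd, hd'⟩⟩
      · exact ⟨0, fun h => absurd h hi⟩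
    choose d hd using hd
    refine ⟨n, hn, d, fun i hi => (hd i hi).1, ?_⟩
    have := key n d
    rw [Finset.sum_congr rfl (fun i hi => by rw [(hd i hi).2]), e] at this
    exact (mul_right_mem_nonZeroDivisors_eq_zero_iff (pow_mem hy n)).1
      (by rw [mul_comm]; exact this.symm)
  · rintro ⟨n, hn, c, hc, e⟩
    refine ⟨n, hn, fun i => y ^ i * c i, fun i hi => ?_, by rw [key, e, mul_zero]⟩
    rw [mul_pow, Ideal.span_singleton_pow]
    exact Ideal.mem_span_singleton_mul.2 ⟨_, hc i hi, rfl⟩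

theorem idealClosure_eq_of_span_singleton_mul {y : A} (hy : y ∈ nonZeroDivisors A)
    {L M : Ideal A}
    (h : idealClosure (Ideal.span {y} * L) = idealClosure (Ideal.span {y} * M)) :
    idealClosure L = idealClosure M := by
  ext a
  rw [← mul_mem_idealClosure_iff hy, h, mul_mem_idealClosure_iff hy]

/-- If `x` is a prime element of a domain, then the ideals `(x ^ n)` are complete. -/
theorem pow_dvd_of_mem_idealClosure [IsDomain A] {x : A} (hx : Prime x) {n : ℕ} {a : A}
    (ha : a ∈ idealClosure (Ideal.span {x ^ n})) : x ^ n ∣ a := by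
  induction n generalizing a with
  | zero => simp
  | succ n ih =>
    have hle : Ideal.span {x ^ (n + 1)} ≤ Ideal.span {x ^ n} :=
      Ideal.span_singleton_le_span_singleton.2 (pow_dvd_pow x n.le_succ)
    obtain ⟨b, rfl⟩ := ih (idealClosure_mono hle ha)
    have e : Ideal.span {x ^ (n + 1)} = Ideal.span {x ^ n} * Ideal.span {x} := by
      rw [Ideal.span_singleton_mul_span_singleton, pow_succ]
    -- After cancelling `x ^ n`, `b` is integral over `(x)`; its equation shows that `x` divides a
    -- power of `b`.
    rw [e, mul_mem_idealClosure_iff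
      (mem_nonZeroDivisors_of_ne_zero (pow_ne_zero n hx.ne_zero))] at ha
    obtain ⟨N, hN, c, hc, h⟩ := ha
    rw [pow_succ]
    refine mul_dvd_mul_left _ (hx.dvd_of_dvd_pow (n := N) ?_)
    rw [eq_neg_of_add_eq_zero_left h, dvd_neg]
    refine Finset.dvd_sum fun i hi => Dvd.dvd.mul_right ?_ _
    have hi' := Finset.mem_Icc.1 hi
    have := hc i hi
    rw [Ideal.span_singleton_pow, Ideal.mem_span_singleton] at this
    exact (dvd_pow_self x (by omega)).trans this

end Closure

/-! ### Valuations separate the powers of an ideal -/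

section Valuation

variable {A : Type*} [CommRing A] {Γ : Type*} [LinearOrderedCommGroupWithZero Γ]

theorem valuation_le_pow (v : Valuation A Γ) (hv : ∀ a, v a ≤ 1) {L : Ideal A} {γ : Γ}
    (hL : ∀ a ∈ L, v a ≤ γ) (n : ℕ) {a : A} (ha : a ∈ L ^ n) : v a ≤ γ ^ n := by
  induction n generalizing a with
  | zero => simpa using hv a
  | succ n ih =>
    rw [pow_succ] at ha
    refine Submodule.mul_induction_on ha (fun b hb c hc => ?_) fun b c => v.map_add_le
    rw [map_mul, pow_succ]
    exact mul_le_mul' (ih hb) (hL c hc)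

/-- If `v a > γ`, every term `cᵢ * a ^ (n - i)` has value below `v a ^ n`, so the terms cannot
cancel `a ^ n`. -/
theorem valuation_le_of_mem_idealClosure (v : Valuation A Γ) (hv : ∀ a, v a ≤ 1) {L : Ideal A}
    {γ : Γ} (hL : ∀ a ∈ L, v a ≤ γ) {a : A} (ha : a ∈ idealClosure L) : v a ≤ γ := by
  obtain ⟨n, hn, c, hc, e⟩ := ha
  by_contra! h
  have h0 : 0 < v a := zero_le.trans_lt h
  have hlt : v (∑ i ∈ Finset.Icc 1 n, c i * a ^ (n - i)) < v a ^ n := by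
    refine v.map_sum_lt (pow_pos h0 n).ne' fun i hi => ?_
    have hi' := Finset.mem_Icc.1 hi
    have e : v a ^ n = v a ^ i * v a ^ (n - i) := by rw [← pow_add]; congr 1; omega
    rw [map_mul, map_pow, e]
    refine mul_lt_mul_of_pos_right ((valuation_le_pow v hv hL i (hc i hi)).trans_lt ?_)
      (pow_pos h0 _)
    exact pow_lt_pow_left₀ h zero_le (by omega)
  rw [eq_neg_of_add_eq_zero_right e, Valuation.map_neg, map_pow] at hlt
  exact lt_irrefl _ hlt

/-- A proper ideal of a domain is contained in the center of a valuation ring. -/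
theorem exists_valuationSubring_of_ne_top {A : Type*} [CommRing A] [IsDomain A] {L : Ideal A}
    (hL : L ≠ ⊤) : ∃ V : ValuationSubring (FractionRing A),
      (∀ a : A, V.valuation (algebraMap A _ a) ≤ 1) ∧
      ∀ a ∈ L, V.valuation (algebraMap A _ a) < 1 := by
  let f := (algebraMap A (FractionRing A))
  let e : A ≃+* f.range := RingEquiv.ofBijective f.rangeRestrict
    ⟨fun a b h => IsFractionRing.injective A (FractionRing A) (congrArg Subtype.val h),
      f.rangeRestrict_surjective⟩
  have hL' : L.map e ≠ ⊤ := fun h => hL <| by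
    have := Ideal.comap_map_of_bijective e e.bijective (I := L)
    rw [← this, h, Ideal.comap_top]
  obtain ⟨V, hV, hLV⟩ := Ideal.image_subset_nonunits_valuationSubring (L.map e) hL'
  refine ⟨V, fun a => (V.valuation_le_one_iff _).2 (hV ⟨a, rfl⟩), fun a ha => ?_⟩
  exact V.mem_nonunits_iff.1 (hLV ⟨e a, Ideal.mem_map_of_mem e ha, rfl⟩)

/-- Finite generation gives `g ∈ L` of largest value `γ` for a valuation centered on `L`. Then `0 <
γ < 1`, and the inclusion yields `γ ^ m ≤ γ ^ n`. -/
theorem le_of_pow_le_idealClosure_pow {A : Type*} [CommRing A] [IsDomain A] {L : Ideal A}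
    (hfg : L.FG) (hL : L ≠ ⊤) (hL0 : L ≠ ⊥) {m n : ℕ} (h : L ^ m ≤ idealClosure (L ^ n)) :
    n ≤ m := by
  obtain ⟨V, hV, hLV⟩ := exists_valuationSubring_of_ne_top hL
  let v := V.valuation.comap (algebraMap A (FractionRing A))
  obtain ⟨s, hs⟩ := hfg
  have hne : s.Nonempty := by
    rw [Finset.nonempty_iff_ne_empty]
    rintro rfl
    exact hL0 (by simpa using hs.symm)
  obtain ⟨g, hg, hmax⟩ := s.exists_max_image v hne
  have hgL : g ∈ L := hs ▸ Submodule.subset_span hg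
  have hle : ∀ a ∈ L, v a ≤ v g := by
    intro a ha
    rw [← hs] at ha
    refine Submodule.span_induction (fun b hb => hmax b hb) (by simp)
      (fun _ _ _ _ => v.map_add_le) (fun r b _ hb => ?_) ha
    rw [smul_eq_mul, map_mul]
    exact mul_le_of_le_one_of_le (hV r) hb
  have hg0 : 0 < v g := by
    rw [zero_lt_iff]
    intro h0
    refine hL0 ((Submodule.eq_bot_iff _).2 fun a ha => ?_)
    have : v a = 0 := le_zero_iff.1 ((hle a ha).trans h0.le)
    exact (map_eq_zero_iff _ (IsFractionRing.injective A (FractionRing A))).1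
      (V.valuation.zero_iff.1 this)
  by_contra! hlt
  have h1 := valuation_le_of_mem_idealClosure v hV
    (fun a => valuation_le_pow v hV hle n) (h (Ideal.pow_mem_pow hgL m))
  rw [map_pow] at h1
  exact absurd h1 (not_le.2 (pow_lt_pow_right_of_lt_one₀ hg0 (hLV g hgL) hlt))

theorem pow_eq_of_idealClosure_pow_eq {A : Type*} [CommRing A] [IsDomain A] {L : Ideal A}
    (hfg : L.FG) (hL : L ≠ ⊤) (hL0 : L ≠ ⊥) {m n : ℕ}
    (h : idealClosure (L ^ m) = idealClosure (L ^ n)) : m = n :=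
  le_antisymm (le_of_pow_le_idealClosure_pow hfg hL hL0 (h ▸ le_idealClosure _))
    (le_of_pow_le_idealClosure_pow hfg hL hL0 (h ▸ le_idealClosure _))

end Valuation

/-! ### Multiplicativity of the order in a regular local ring -/

section RegularLocalRing

open MvPolynomial

theorem eval_mul_of_isHomogeneous {ι A : Type*} [CommRing A] {F : MvPolynomial ι A} {n : ℕ}
    (hF : F.IsHomogeneous n) (t : A) (c : ι → A) :
    eval (fun i => t * c i) F = t ^ n * eval c F := by
  rw [eval_eq, eval_eq, Finset.mul_sum]
  refine Finset.sum_congr rfl fun d hd => ?_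
  have hdeg : ∑ i ∈ d.support, d i = n := (hF.degree_eq_sum_deg_support hd).symm
  simp only [mul_pow]
  rw [Finset.prod_mul_distrib, Finset.prod_pow_eq_pow_sum, hdeg]
  ring

theorem eval_mem_mul_pow {ι A : Type*} [CommRing A] {F : MvPolynomial ι A} {n : ℕ}
    (hF : F.IsHomogeneous n) {P M : Ideal A} (hP : ∀ d, F.coeff d ∈ P) {y : ι → A}
    (hy : ∀ i, y i ∈ M) : eval y F ∈ P * M ^ n := by
  rw [eval_eq]
  refine Ideal.sum_mem _ fun d hd => Ideal.mul_mem_mul (hP d) ?_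
  have hdeg : ∑ i ∈ d.support, d i = n := (hF.degree_eq_sum_deg_support hd).symm
  rw [← hdeg, ← Finset.prod_pow_eq_pow_sum]
  exact Ideal.prod_mem_prod fun i _ => Ideal.pow_mem_pow (hy i) _

variable {R : Type*} [CommRing R] [IsRegularLocalRing R]

theorem exists_finset_span_eq_maximalIdeal : ∃ s : Finset R,
    Ideal.span (s : Set R) = maximalIdeal R ∧ ((s.card : ℕ∞) : WithBot ℕ∞) = ringKrullDim R := by
  obtain ⟨s, hs, hs'⟩ := Submodule.FG.exists_span_finset_card_eq_spanFinrank
    (IsNoetherian.noetherian (maximalIdeal R))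
  exact ⟨s, hs', by rw [hs]; exact_mod_cast IsRegularLocalRing.spanFinrank_maximalIdeal⟩

/-- The maximal ideal of a regular local ring is not the radical of an ideal with fewer
generators than the dimension. -/
theorem not_maximalIdeal_le_radical_span {t : Finset R}
    (ht : ((t.card : ℕ∞) : WithBot ℕ∞) < ringKrullDim R)
    (htm : Ideal.span (t : Set R) ≤ maximalIdeal R) :
    ¬ maximalIdeal R ≤ (Ideal.span (t : Set R)).radical := by
  intro h
  -- Otherwise `𝔪` is a minimal prime of `(t)`, against Krull's height theorem.
  have hmin : maximalIdeal R ∈ (Ideal.span (t : Set R)).minimalPrimes :=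
    ⟨⟨inferInstance, htm⟩, fun q hq _ => h.trans (hq.1.radical_le_iff.2 hq.2)⟩
  have := Ideal.height_le_card_of_mem_minimalPrimes_span_finset hmin
  rw [← IsLocalRing.maximalIdeal_height_eq_ringKrullDim] at ht
  exact absurd (WithBot.coe_lt_coe.1 ht) (not_lt.2 this)

/-- A minimal system of generators of the maximal ideal of a regular local ring is analytically
independent. -/
theorem eval_notMem_pow_succ [Infinite (ResidueField R)] {s : Finset R}
    (hs : Ideal.span (s : Set R) = maximalIdeal R)
    (hcard : ((s.card : ℕ∞) : WithBot ℕ∞) = ringKrullDim R) (hne : s.Nonempty)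
    {F : MvPolynomial s R} {n : ℕ} (hF : F.IsHomogeneous n)
    (hF0 : map (residue R) F ≠ 0) :
    eval (fun i : s => (i : R)) F ∉ maximalIdeal R ^ (n + 1) := by
  classical
  intro hmem
  obtain ⟨y₀, hy₀⟩ := hne
  -- An infinite field has a point where the reduced form is nonzero; the factor `X` keeps the
  -- `y₀`-coordinate nonzero too.
  obtain ⟨c', hc'⟩ : ∃ c' : s → ResidueField R,
      eval c' (map (residue R) F * X ⟨y₀, hy₀⟩) ≠ 0 := by
    by_contra! h
    exact mul_ne_zero hF0 (X_ne_zero _) (MvPolynomial.funext (by simpa using h))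
  obtain ⟨c, rfl⟩ : ∃ c : s → R, (fun i => residue R (c i)) = c' :=
    ⟨fun i => (residue_surjective (c' i)).choose, funext fun i => (residue_surjective _).choose_spec⟩
  rw [map_mul, eval_X, eval_map, show eval₂ (residue R) (fun i => residue R (c i)) F =
    residue R (eval c F) from (eval₂_comp (residue R) c F).symm] at hc'
  have hFc : IsUnit (eval c F) := (residue_ne_zero_iff_isUnit _).1 (left_ne_zero_of_mul hc')
  have hu : IsUnit (c ⟨y₀, hy₀⟩) := (residue_ne_zero_iff_isUnit _).1 (right_ne_zero_of_mul hc')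
  set u := c ⟨y₀, hy₀⟩
  -- Modulo these elements, one fewer than the generators, `y` is proportional to `c`, so `y₀`
  -- generates `𝔪`. The goal is that `y₀` becomes nilpotent.
  let g : s → R := fun i => u * i - y₀ * c i
  let t : Finset R := (Finset.univ.erase (⟨y₀, hy₀⟩ : s)).image g
  have hgt : ∀ i, g i ∈ Ideal.span (t : Set R) := by
    intro i
    by_cases hi : i = ⟨y₀, hy₀⟩
    · have : g i = 0 := by rw [hi]; simp only [g, u]; ring
      rw [this]; exact zero_mem _
    · exact Ideal.subset_span (Finset.mem_coe.2 (Finset.mem_image_of_mem g (by simp [hi])))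
  have hsm : ∀ i : s, (i : R) ∈ maximalIdeal R := fun i => hs ▸ Ideal.subset_span i.2
  have htm : Ideal.span (t : Set R) ≤ maximalIdeal R := by
    rw [Ideal.span_le]
    intro z hz
    obtain ⟨i, -, rfl⟩ := Finset.mem_image.1 (Finset.mem_coe.1 hz)
    exact Ideal.sub_mem _ (Ideal.mul_mem_left _ _ (hsm i))
      (Ideal.mul_mem_right _ _ (hsm ⟨y₀, hy₀⟩))
  have htcard : ((t.card : ℕ∞) : WithBot ℕ∞) < ringKrullDim R := by
    rw [← hcard]
    have h1 : t.card ≤ s.card - 1 := by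
      refine Finset.card_image_le.trans ?_
      rw [Finset.card_erase_of_mem (Finset.mem_univ _), Finset.card_univ, Fintype.card_coe]
    have h2 : 0 < s.card := Finset.card_pos.2 ⟨y₀, hy₀⟩
    exact_mod_cast (by omega : t.card < s.card)
  refine not_maximalIdeal_le_radical_span htcard htm ?_
  let q := Ideal.Quotient.mk (Ideal.span (t : Set R))
  have hq : ∀ i : s, q u * q i = q y₀ * q (c i) := by
    intro i
    rw [← map_mul, ← map_mul, Ideal.Quotient.eq]
    exact hgt i
  have hmap : (maximalIdeal R).map q ≤ Ideal.span {q y₀} := by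
    rw [← hs, Ideal.map_span, Ideal.span_le]
    rintro _ ⟨i, hi, rfl⟩
    rw [SetLike.mem_coe, ← (hu.map q).dvd_mul_left.trans Ideal.mem_span_singleton.symm,
      hq ⟨i, hi⟩]
    exact dvd_mul_right _ _
  have hpow : q (eval (fun i : s => (i : R)) F) ∈ Ideal.span {q y₀ ^ (n + 1)} := by
    rw [← Ideal.span_singleton_pow]
    refine Ideal.pow_right_mono hmap (n + 1) ?_
    rw [← Ideal.map_pow]
    exact Ideal.mem_map_of_mem q hmem
  obtain ⟨w', hw'⟩ := Ideal.mem_span_singleton.1 hpow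
  obtain ⟨w, rfl⟩ := Ideal.Quotient.mk_surjective w'
  have hscale : q u ^ n * q (eval (fun i : s => (i : R)) F) = q y₀ ^ n * q (eval c F) := by
    have e1 : q (eval (fun i : s => u * (i : R)) F) = q (eval (fun i : s => y₀ * c i) F) := by
      rw [eval₂_comp, eval₂_comp]
      congr 1
      funext i
      simpa using hq i
    rwa [eval_mul_of_isHomogeneous hF, eval_mul_of_isHomogeneous hF, map_mul, map_mul, map_pow,
      map_pow] at e1
  have hunit : IsUnit (eval c F - u ^ n * (y₀ * w)) := by
    by_contra h
    have h1 : eval c F - u ^ n * (y₀ * w) ∈ maximalIdeal R := h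
    have h2 : u ^ n * (y₀ * w) ∈ maximalIdeal R :=
      Ideal.mul_mem_left _ _ (Ideal.mul_mem_right _ _ (hsm ⟨y₀, hy₀⟩))
    exact (by simpa using Ideal.add_mem _ h1 h2 : eval c F ∈ maximalIdeal R) hFc
  -- `hscale` and `hw'` give `y₀ ^ n * (F(c) - u ^ n * y₀ * w) = 0` in the quotient, and the second
  -- factor is a unit.
  have hzero : q y₀ ^ n = 0 := by
    refine (hunit.map q).mul_left_eq_zero.1 ?_
    rw [map_sub, mul_sub, ← hscale, hw']
    simp only [map_mul, map_pow, q]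
    ring
  rw [← map_pow, Ideal.Quotient.eq_zero_iff_mem] at hzero
  have hy₀r : y₀ ∈ (Ideal.span (t : Set R)).radical := ⟨n, hzero⟩
  rw [← hs, Ideal.span_le]
  intro i hi
  have h1 : u * i ∈ (Ideal.span (t : Set R)).radical := by
    have := Ideal.add_mem _ (Ideal.le_radical (hgt ⟨i, hi⟩))
      (Ideal.mul_mem_right (c ⟨i, hi⟩) _ hy₀r)
    simpa [g] using this
  exact (Ideal.unit_mul_mem_iff_mem _ hu).1 h1

/-- The `𝔪`-adic order of a regular local ring is multiplicative, that is, the associated graded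
ring is a domain. -/
theorem mem_pow_succ_or_of_mul_mem [Infinite (ResidueField R)] (hdim : 0 < ringKrullDim R)
    {m n : ℕ} {f g : R} (hf : f ∈ maximalIdeal R ^ m) (hg : g ∈ maximalIdeal R ^ n)
    (hfg : f * g ∈ maximalIdeal R ^ (m + n + 1)) :
    f ∈ maximalIdeal R ^ (m + 1) ∨ g ∈ maximalIdeal R ^ (n + 1) := by
  obtain ⟨s, hs, hcard⟩ := exists_finset_span_eq_maximalIdeal (R := R)
  have hne : s.Nonempty := by
    rw [Finset.nonempty_iff_ne_empty]
    rintro rfl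
    rw [← hcard] at hdim
    simp at hdim
  have hrange : Ideal.span (Set.range fun i : s => (i : R)) = maximalIdeal R := by
    rw [← hs]; congr 1; simp
  have hsm : ∀ i : s, (i : R) ∈ maximalIdeal R := fun i => hs ▸ Ideal.subset_span i.2
  -- So if neither order jumps, both forms have nonzero reductions, hence so does their product, and
  -- analytic independence applies.
  have key : ∀ {k : ℕ} {F : MvPolynomial s R}, F.IsHomogeneous k → map (residue R) F = 0 →
      eval (fun i : s => (i : R)) F ∈ maximalIdeal R ^ (k + 1) := by
    intro k F hF h
    rw [pow_succ']
    refine eval_mem_mul_pow hF (fun d => ?_) hsm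
    rw [← residue_eq_zero_iff, ← coeff_map, h, coeff_zero]
  rw [← hrange, Ideal.mem_span_pow_iff_exists_isHomogeneous] at hf hg
  obtain ⟨F, hF, rfl⟩ := hf
  obtain ⟨G, hG, rfl⟩ := hg
  by_contra! h
  rw [← map_mul] at hfg
  refine eval_notMem_pow_succ hs hcard hne (hF.mul hG) ?_ hfg
  rw [map_mul]
  exact mul_ne_zero (fun h0 => h.1 (key hF h0)) fun h0 => h.2 (key hG h0)

theorem pow_notMem_pow_succ [Infinite (ResidueField R)] (hdim : 0 < ringKrullDim R) {x : R}
    (hx : x ∈ maximalIdeal R) (hx2 : x ∉ maximalIdeal R ^ 2) (n : ℕ) :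
    x ^ n ∉ maximalIdeal R ^ (n + 1) := by
  induction n with
  | zero => simp
  | succ n ih =>
    intro h
    rw [pow_succ x] at h
    rcases mem_pow_succ_or_of_mul_mem hdim (Ideal.pow_mem_pow hx n)
      (by rwa [pow_one]) h with h | h
    · exact ih h
    · exact hx2 h

end RegularLocalRing

/-! ### The chart `R[𝔪/x]` and its exceptional divisor -/

section BlowupChart

variable {R : Type*} [CommRing R] (K : Type*) [Field K] [Algebra R K]

theorem div_mem_blowupChart {I : Ideal R} (x : R) {n : ℕ} {f : R} (hf : f ∈ I ^ n) :
    algebraMap R K f / algebraMap R K x ^ n ∈ blowupChart K I x := by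
  induction n generalizing f with
  | zero => simp
  | succ n ih =>
    rw [pow_succ I] at hf
    refine Submodule.mul_induction_on hf (fun a ha b hb => ?_) fun a b ha hb => ?_
    · rw [map_mul, pow_succ (algebraMap R K x), mul_div_mul_comm]
      exact Subalgebra.mul_mem _ (ih ha) (Algebra.subset_adjoin ⟨b, hb, rfl⟩)
    · rw [map_add, add_div]
      exact Subalgebra.add_mem _ ha hb

variable {K} [IsFractionRing R K]

theorem exists_eq_div_of_mem_blowupChart {I : Ideal R} {x : R} (hx : x ∈ I) (hx0 : x ≠ 0) {z : K}
    (hz : z ∈ blowupChart K I x) :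
    ∃ (n : ℕ) (f : R), f ∈ I ^ n ∧ z = algebraMap R K f / algebraMap R K x ^ n := by
  have hx0' : algebraMap R K x ≠ 0 :=
    (map_ne_zero_iff _ (IsFractionRing.injective R K)).2 hx0
  refine Algebra.adjoin_induction ?_ ?_ ?_ ?_ hz
  · rintro _ ⟨y, hy, rfl⟩
    exact ⟨1, y, by rwa [pow_one], by rw [pow_one]⟩
  · intro r
    exact ⟨0, r, by simp, by simp⟩
  · rintro _ _ _ _ ⟨n, f, hf, rfl⟩ ⟨m, g, hg, rfl⟩
    refine ⟨n + m, f * x ^ m + x ^ n * g, Ideal.add_mem _ ?_ ?_, ?_⟩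
    · rw [pow_add]; exact Ideal.mul_mem_mul hf (Ideal.pow_mem_pow hx m)
    · rw [pow_add]; exact Ideal.mul_mem_mul (Ideal.pow_mem_pow hx n) hg
    · simp only [map_add, map_mul, map_pow]
      field_simp
      ring
  · rintro _ _ _ _ ⟨n, f, hf, rfl⟩ ⟨m, g, hg, rfl⟩
    refine ⟨n + m, f * g, ?_, ?_⟩
    · rw [pow_add]; exact Ideal.mul_mem_mul hf hg
    · rw [map_mul, pow_add, mul_div_mul_comm]

variable [IsRegularLocalRing R] [Infinite (ResidueField R)]

/-- Clearing denominators in `f / x ^ n = x * (g / x ^ p)` gives `f * x ^ p = x ^ (n + 1) * g`.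
Since `x ^ p` has order exactly `p`, the surplus order falls on `f`. -/
theorem mem_pow_succ_of_algebraMap_dvd (hdim : 0 < ringKrullDim R) {x : R}
    (hx : x ∈ maximalIdeal R) (hx2 : x ∉ maximalIdeal R ^ 2) {n : ℕ} {f : R}
    (hf : f ∈ maximalIdeal R ^ n) {z : blowupChart K (maximalIdeal R) x}
    (hz : (z : K) = algebraMap R K f / algebraMap R K x ^ n)
    (hdvd : algebraMap R (blowupChart K (maximalIdeal R) x) x ∣ z) :
    f ∈ maximalIdeal R ^ (n + 1) := by
  have hx0 : x ≠ 0 := by rintro rfl; exact hx2 (zero_mem _)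
  have hx0' : algebraMap R K x ≠ 0 :=
    (map_ne_zero_iff _ (IsFractionRing.injective R K)).2 hx0
  obtain ⟨w, rfl⟩ := hdvd
  obtain ⟨p, g, hg, hw⟩ := exists_eq_div_of_mem_blowupChart hx hx0 w.2
  have e : algebraMap R K (x ^ (n + 1) * g) = algebraMap R K (f * x ^ p) := by
    have h1 : algebraMap R K x * (algebraMap R K g / algebraMap R K x ^ p) =
        algebraMap R K f / algebraMap R K x ^ n := by
      rw [← hw, ← hz]; rfl
    simp only [map_mul, map_pow]
    field_simp at h1
    linear_combination h1
  have e' := IsFractionRing.injective R K e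
  have hmem : f * x ^ p ∈ maximalIdeal R ^ (n + p + 1) := by
    rw [← e', show n + p + 1 = n + 1 + p by omega, pow_add]
    exact Ideal.mul_mem_mul (Ideal.pow_mem_pow hx _) hg
  exact (mem_pow_succ_or_of_mul_mem hdim hf (Ideal.pow_mem_pow hx p) hmem).resolve_right
    (pow_notMem_pow_succ hdim hx hx2 p)

/-- The exceptional divisor is irreducible in the chart `R[𝔪/x]`. -/
theorem prime_algebraMap_blowupChart (hdim : 0 < ringKrullDim R) {x : R}
    (hx : x ∈ maximalIdeal R) (hx2 : x ∉ maximalIdeal R ^ 2) :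
    Prime (algebraMap R (blowupChart K (maximalIdeal R) x) x) := by
  have hx0 : x ≠ 0 := by rintro rfl; exact hx2 (zero_mem _)
  have hx0' : algebraMap R K x ≠ 0 :=
    (map_ne_zero_iff _ (IsFractionRing.injective R K)).2 hx0
  have hdvd : ∀ {n : ℕ} {f : R}, f ∈ maximalIdeal R ^ (n + 1) →
      ∀ {z : blowupChart K (maximalIdeal R) x},
      (z : K) = algebraMap R K f / algebraMap R K x ^ n →
      algebraMap R (blowupChart K (maximalIdeal R) x) x ∣ z := by
    intro n f hf z hz
    refine ⟨⟨_, div_mem_blowupChart K x hf⟩, Subtype.ext ?_⟩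
    rw [hz]
    change _ = algebraMap R K x * _
    field_simp
    ring
  refine ⟨fun h => hx0' (congrArg Subtype.val h), fun h => ?_, fun z w h => ?_⟩
  · have := mem_pow_succ_of_algebraMap_dvd (K := K) hdim hx hx2 (n := 0) (f := 1) (by simp)
      (z := 1) (by simp) h.dvd
    simp at this
  · obtain ⟨n, f, hf, hz⟩ := exists_eq_div_of_mem_blowupChart hx hx0 z.2
    obtain ⟨p, g, hg, hw⟩ := exists_eq_div_of_mem_blowupChart hx hx0 w.2
    have hfg : f * g ∈ maximalIdeal R ^ (n + p + 1) := by
      refine mem_pow_succ_of_algebraMap_dvd hdim hx hx2 ?_ (z := z * w) ?_ h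
      · rw [pow_add]; exact Ideal.mul_mem_mul hf hg
      · rw [map_mul, pow_add, mul_div_mul_comm, ← hz, ← hw]; rfl
    exact (mem_pow_succ_or_of_mul_mem hdim hf hg hfg).imp (hdvd · hz) (hdvd · hw)

end BlowupChart

/-! ### Splitting off powers of a prime element -/

section PrimeElement

variable {A : Type*} [CommRing A]

theorem exists_eq_span_singleton_mul {M : Ideal A} {a : A} (h : M ≤ Ideal.span {a}) :
    ∃ L, M = Ideal.span {a} * L := by
  refine ⟨M.colon {a}, le_antisymm (fun b hb => ?_) ?_⟩
  · obtain ⟨c, rfl⟩ := Ideal.mem_span_singleton.1 (h hb)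
    exact Ideal.mem_span_singleton_mul.2
      ⟨c, Submodule.mem_colon_singleton.2 (by simpa [mul_comm] using hb), rfl⟩
  · intro b hb
    obtain ⟨c, hc, rfl⟩ := Ideal.mem_span_singleton_mul.1 hb
    simpa [mul_comm] using Submodule.mem_colon_singleton.1 hc

variable [IsDomain A]

/-- Makes the transform finitely generated without a Noetherian hypothesis on the extension ring. -/
theorem fg_of_span_singleton_mul {a : A} (ha : a ≠ 0) {L : Ideal A}
    (h : (Ideal.span {a} * L).FG) : L.FG := by
  refine Submodule.fg_of_fg_map_injective (LinearMap.mulLeft A a)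
    (mul_right_injective₀ ha) ?_
  have e : Submodule.map (LinearMap.mulLeft A a) L = Ideal.span {a} * L := by
    ext b
    simp [Ideal.mem_span_singleton_mul]
  rwa [e]

/-- Each division by `p` lowers the exponent of a power of `p` in the ideal, so the process stops.
-/
theorem exists_eq_span_prime_pow_mul {p : A} (hp : Prime p) {n : ℕ} {M : Ideal A}
    (h : p ^ n ∈ M) :
    ∃ (s : ℕ) (L : Ideal A), M = Ideal.span {p ^ s} * L ∧ ¬ L ≤ Ideal.span {p} := by
  by_cases hM : M ≤ Ideal.span {p}
  · induction n generalizing M with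
    | zero => exact absurd (Ideal.mem_span_singleton.1 (hM h)) (by simpa using hp.not_dvd_one)
    | succ n ih =>
      obtain ⟨M', rfl⟩ := exists_eq_span_singleton_mul hM
      obtain ⟨c, hc, hc'⟩ := Ideal.mem_span_singleton_mul.1 h
      rw [pow_succ', mul_right_inj' hp.ne_zero] at hc'
      subst hc'
      by_cases hM' : M' ≤ Ideal.span {p}
      · obtain ⟨s, L, rfl, hL⟩ := ih hc hM'
        exact ⟨s + 1, L, by
          rw [pow_succ', ← Ideal.span_singleton_mul_span_singleton, mul_assoc], hL⟩
      · exact ⟨1, M', by rw [pow_one], hM'⟩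
  · exact ⟨0, M, by simp, hM⟩

/-- For `f ∈ L` outside `(p)`, completeness of `(p ^ (s * i))` makes `p ^ (s * i)` divide `p ^ (r *
j) * f ^ j`, and `p` does not divide `f ^ j`. -/
theorem mul_le_mul_of_idealClosure_le {p : A} (hp : Prime p) {r s i j : ℕ}
    {L M : Ideal A} (hL : ¬ L ≤ Ideal.span {p})
    (h : idealClosure ((Ideal.span {p ^ r} * L) ^ j) ≤
      idealClosure ((Ideal.span {p ^ s} * M) ^ i)) : s * i ≤ r * j := by
  obtain ⟨f, hf, hfp⟩ := SetLike.not_le_iff_exists.1 hL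
  have h1 : (p ^ r * f) ^ j ∈ idealClosure (Ideal.span {p ^ (s * i)}) := by
    have hle : (Ideal.span {p ^ s} * M) ^ i ≤ Ideal.span {p ^ (s * i)} := by
      rw [mul_pow, Ideal.span_singleton_pow, ← pow_mul]
      exact Ideal.mul_le_left
    exact idealClosure_mono hle (h (le_idealClosure _ (Ideal.pow_mem_pow
      (Ideal.mul_mem_mul (Ideal.mem_span_singleton_self _) hf) j)))
  have h2 := pow_dvd_of_mem_idealClosure hp h1
  rw [mul_pow, ← pow_mul] at h2
  have h3 := hp.pow_dvd_of_dvd_mul_right _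
    (fun h => hfp (Ideal.mem_span_singleton.2 (hp.dvd_of_dvd_pow h))) h2
  exact (pow_dvd_pow_iff hp.ne_zero hp.not_isUnit).1 h3

/-- The divisorial part of an ideal that contains a power of a prime element `p` is a power
of `p`. -/
theorem exists_eq_span_prime_pow_of_isLeast {p : A} (hp : Prime p) {n : ℕ} {a : A}
    {M L : Ideal A} (h : p ^ n ∈ M)
    (hleast : IsLeast {P : Ideal A | Submodule.IsPrincipal P ∧ M ≤ P} (Ideal.span {a}))
    (hML : M = Ideal.span {a} * L) :
    ∃ r, Ideal.span {a} = Ideal.span {p ^ r} ∧ ¬ L ≤ Ideal.span {p} := by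
  obtain ⟨r, -, hr⟩ := (dvd_prime_pow hp n).1 (Ideal.mem_span_singleton.1 (hleast.1.2 h))
  have hspan : Ideal.span {a} = Ideal.span {p ^ r} := Ideal.span_singleton_eq_span_singleton.2 hr
  refine ⟨r, hspan, fun hL => ?_⟩
  -- Another factor `p` in `L` would put `M` in a smaller principal ideal.
  have h1 : Ideal.span {a} ≤ Ideal.span {p ^ (r + 1)} := by
    refine hleast.2 ⟨⟨_, rfl⟩, ?_⟩
    rw [hML, hspan, pow_succ, ← Ideal.span_singleton_mul_span_singleton]
    exact Ideal.mul_mono_right hL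
  rw [hspan, Ideal.span_singleton_le_span_singleton,
    pow_dvd_pow_iff hp.ne_zero hp.not_isUnit] at h1
  omega

end PrimeElement

/-- Descent of projective fullness along `A → B`, when an element of the radical of `I` becomes
prime in `B`. -/
theorem IsProjectivelyFull.of_isTransform {A B : Type*} [CommRing A] [CommRing B] [IsDomain B]
    [Algebra A B] {x : A} (hp : Prime (algebraMap A B x)) {I : Ideal A} (hfg : I.FG)
    (hI : I ≠ ⊤) (hxr : x ∈ I.radical) (hreg : ∃ a ∈ I, a ∈ nonZeroDivisors A)
    {I₁ : Ideal B} (hI₁ : IsTransform I I₁) (hfull : IsProjectivelyFull I₁) :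
    IsProjectivelyFull I := by
  refine ⟨hI, hreg, ?_⟩
  rintro J hJ ⟨i, j, hi, hj, hij⟩
  obtain ⟨n, hn⟩ := hxr
  have hxI : algebraMap A B x ^ n ∈ I.map (algebraMap A B) := by
    rw [← map_pow]; exact Ideal.mem_map_of_mem _ hn
  -- `x ^ (n * j)` lies in `I ^ j`, hence in the closure of `J ^ i`, hence in the complete ideal
  -- `J`.
  have hxJ : algebraMap A B x ^ (n * j) ∈ J.map (algebraMap A B) := by
    rw [← map_pow, pow_mul]
    refine Ideal.mem_map_of_mem _ (hJ.le (idealClosure_mono (Ideal.pow_le_self hi.ne') ?_))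
    rw [← hij]
    exact le_idealClosure _ (Ideal.pow_mem_pow hn j)
  obtain ⟨a, ha0, hleast, hIa⟩ := hI₁
  obtain ⟨r, har, hI₁p⟩ := exists_eq_span_prime_pow_of_isLeast hp hxI hleast hIa
  obtain ⟨s, J₁, hJs, hJ₁p⟩ := exists_eq_span_prime_pow_mul hp hxJ
  have hcl := idealClosure_map_congr (algebraMap A B) hij
  rw [Ideal.map_pow, Ideal.map_pow, hIa, har, hJs] at hcl
  have hrs : r * j = s * i := le_antisymm (mul_le_mul_of_idealClosure_le hp hJ₁p hcl.ge)
    (mul_le_mul_of_idealClosure_le hp hI₁p hcl.le)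
  rw [mul_pow, mul_pow, Ideal.span_singleton_pow, Ideal.span_singleton_pow, ← pow_mul,
    ← pow_mul, ← hrs] at hcl
  have hcl₁ := idealClosure_eq_of_span_singleton_mul
    (mem_nonZeroDivisors_of_ne_zero (pow_ne_zero _ hp.ne_zero)) hcl
  obtain ⟨k, hk, hJ₁k⟩ := hfull.full (idealClosure J₁) (idealClosure_idealClosure J₁)
    ⟨i, j, hi, hj, by rw [idealClosure_idealClosure_pow, hcl₁]⟩
  have hI₁fg : I₁.FG := fg_of_span_singleton_mul ha0 (hIa ▸ hfg.map _)
  have hI₁0 : I₁ ≠ ⊥ := fun h => hI₁p (h ▸ bot_le)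
  -- Both powers of `I₁` have the closure of `J₁ ^ i`.
  have hjk : j = k * i := by
    refine pow_eq_of_idealClosure_pow_eq hI₁fg hfull.proper hI₁0 ?_
    rw [hcl₁, ← idealClosure_idealClosure_pow, hJ₁k, idealClosure_idealClosure_pow, pow_mul]
  refine ⟨k, hk, hJ.symm.trans (idealClosure_eq_of_pow hi ?_)⟩
  rw [← hij, hjk, pow_mul]

end ProjFull

theorem proposition4p7 {R : Type*} [CommRing R] [IsRegularLocalRing R]
    (hdim : 2 ≤ ringKrullDim R) [Infinite (ResidueField R)]
    (K : Type*) [Field K] [Algebra R K] [IsFractionRing R K]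
    (I : Ideal R) (hprim : I.IsPrimary) (hrad : I.radical = maximalIdeal R)
    (hI : ProjFull.IsCompleteIdeal I)
    (x : R) (hx : x ∈ maximalIdeal R) (hx2 : x ∉ maximalIdeal R ^ 2)
    (hxV : ∀ V ∈ ProjFull.reesValuationRings K I,
      ProjFull.GeneratesIn x (maximalIdeal R) V)
    (I₁ : Ideal (ProjFull.blowupChart K (maximalIdeal R) x))
    (hI₁ : ProjFull.IsTransform I I₁)
    (hfull : ProjFull.IsProjectivelyFull I₁) :
    ProjFull.IsProjectivelyFull I := by
  have : IsDomain R := (IsFractionRing.injective R K).isDomain (algebraMap R K)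
  have hp := ProjFull.prime_algebraMap_blowupChart (K := K)
    (lt_of_lt_of_le (by norm_num) hdim) hx hx2
  have hx0 : x ≠ 0 := by rintro rfl; exact hx2 (zero_mem _)
  have hxr : x ∈ I.radical := hrad ▸ hx
  have hne : I ≠ ⊤ := hprim.ne_top
  refine hfull.of_isTransform hp (IsNoetherian.noetherian I) hne hxr ?_ hI₁
  obtain ⟨n, hn⟩ := hxr
  exact ⟨x ^ n, hn, mem_nonZeroDivisors_of_ne_zero (pow_ne_zero n hx0)⟩
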